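/- Let $m,e$ be integers with $m\equiv 0\pmod 4$, $1\le e\le m/2$ and $\gcd(m,e)=2$. Let $\alpha$ be a generator of $\mathbb F_{2^m}^*$, let $\mathbb M_{\beta}(x)$ denote the minimal polynomial of $\beta$ over $\mathbb F_2$, and let $\mathcal C_E$, for $E=\{e\}$, be the binary cyclic code of length $2^m-1$ with generator polynomial $g_E(x)=\mathbb M_{\alpha}(x)\,\mathbb M_{\alpha^{1+2^e}}(x)$. Let $\overline{\mathcal C_E}$ be the extended code, obtained by appending to each codeword a parity coordinate that makes the coordinates sum to $0$, and let $\overline A_k$ be the number of codewords of Hamming weight $k$ in $\overline{\mathcal C_E}$. Then $\overline{\mathcal C_E}$ has parameters (length, dimension, minimum distance) $[2^m,\,2^m-1-2m,\,4]$ if $m\ge 8$, and $[16,9,4]$ if $m=4$. In all cases $$\overline A_4=\frac{2^m(2^m-1)}{12},\qquad \overline A_6=\frac{2^m(2^m-1)(2^{2m-4}+2^{m-1}+6)}{45},$$ $$\overline A_8=\frac{2^{m-3}(2^m-1)\left(2^{4m-4}-27\cdot 2^{3m-4}+23\cdot 2^{2m-1}+261\cdot 2^{m-2}+403\right)}{315}.$$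 -/

import Mathlib

open Polynomial

noncomputable section

namespace BinaryCode

/-- The polynomial `c₀ + c₁ X + ⋯ + c_{n-1} X ^ (n-1)` of a word `(c₀, …, c_{n-1})`. -/
def wordPoly (n : ℕ) : (Fin n → ZMod 2) →ₗ[ZMod 2] (ZMod 2)[X] :=
  ∑ i : Fin n, (monomial (i : ℕ)) ∘ₗ (LinearMap.proj i)

/-- The binary cyclic code of length `n` with generator polynomial `g`: the words whose class in
`𝔽₂[X] / (X ^ n - 1)` lies in the ideal generated by (the class of) `g`. -/
def cyclicCode (n : ℕ) (g : (ZMod 2)[X]) : Submodule (ZMod 2) (Fin n → ZMod 2) :=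
  ((Ideal.span {Ideal.Quotient.mk (Ideal.span {(X ^ n - 1 : (ZMod 2)[X])}) g}).restrictScalars
    (ZMod 2)).comap
    ((Ideal.Quotient.mkₐ (ZMod 2) (Ideal.span {(X ^ n - 1 : (ZMod 2)[X])})).toLinearMap ∘ₗ
      wordPoly n)

/-- The extended code: a parity coordinate is appended to every word, so that the coordinates of
each extended word sum to zero. -/
def extend {n : ℕ} (C : Submodule (ZMod 2) (Fin n → ZMod 2)) :
    Submodule (ZMod 2) (Fin (n + 1) → ZMod 2) where
  carrier := {c | (fun i : Fin n => c i.castSucc) ∈ C ∧ ∑ i, c i = 0}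
  zero_mem' := ⟨C.zero_mem, by simp⟩
  add_mem' := by
    rintro a b ⟨ha, ha'⟩ ⟨hb, hb'⟩
    exact ⟨C.add_mem ha hb, by simp [Finset.sum_add_distrib, ha', hb']⟩
  smul_mem' := by
    rintro r a ⟨ha, ha'⟩
    exact ⟨C.smul_mem r ha, by simp [← Finset.mul_sum, ha']⟩

/-- `A_k`: the number of codewords of Hamming weight `k`. -/
def weightCount {ι : Type*} [Fintype ι] (C : Submodule (ZMod 2) (ι → ZMod 2)) (k : ℕ) : ℕ :=
  Set.ncard {c : ι → ZMod 2 | c ∈ C ∧ hammingNorm c = k}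

/-- `C` is an `[n, κ, d]` code: it has length `n`, dimension `κ` and minimum nonzero Hamming
weight `d`. -/
def HasParameters {ι : Type*} [Fintype ι] (C : Submodule (ZMod 2) (ι → ZMod 2))
    (n κ d : ℕ) : Prop :=
  Fintype.card ι = n ∧ Module.finrank (ZMod 2) C = κ ∧
    IsLeast {w : ℕ | ∃ c ∈ C, c ≠ 0 ∧ hammingNorm c = w} d

/-- The monic least common multiple of a finite family of polynomials over `𝔽₂`. -/
def polyLcm (E : Finset ℕ) (f : ℕ → (ZMod 2)[X]) : (ZMod 2)[X] :=
  letI : NormalizedGCDMonoid (ZMod 2)[X] :=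
    UniqueFactorizationMonoid.toNormalizedGCDMonoid (ZMod 2)[X]
  E.lcm f

/-- `g_E = M_α · lcm {M_{α ^ (1 + 2 ^ e)} : e ∈ E}`, where `M_β` is the minimal polynomial of `β`
over `𝔽₂`. -/
def genPoly {F : Type*} [Field F] [Algebra (ZMod 2) F] (α : F) (E : Finset ℕ) : (ZMod 2)[X] :=
  minpoly (ZMod 2) α * polyLcm E (fun e => minpoly (ZMod 2) (α ^ (1 + 2 ^ e)))

/-- The extended code of the binary cyclic code of length `2 ^ m - 1` with generator polynomial
`g_E`; its length is `2 ^ m`. -/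
def extCode {F : Type*} [Field F] [Algebra (ZMod 2) F] (m : ℕ) (α : F) (E : Finset ℕ) :
    Submodule (ZMod 2) (Fin (2 ^ m - 1 + 1) → ZMod 2) :=
  extend (cyclicCode (2 ^ m - 1) (genPoly α E))

end BinaryCode

end

/-!
Label the coordinates of the extended code by the elements of `F = 𝔽_q`, `q = 2 ^ m`: the `i`-th
cyclic coordinate by `α ^ i` and the parity coordinate by `0`. The generator polynomial is a product
of two coprime minimal polynomials, so a word is a codeword exactly when its support `W` has even
size and `∑ x ∈ W, x = 0`, `∑ x ∈ W, x ^ (1 + 2 ^ e) = 0` (`mem_extCode_iff`). Hence for even `k`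
the number of codewords of weight `k` is the number of such `k`-subsets (`weightCount_extCode`).

By orthogonality of characters, `q ^ 2` times that number is the sum over `a, b ∈ F` of the `k`-th
elementary symmetric function of the signs `(-1) ^ Tr (a x ^ (1 + 2 ^ e) + b x)`, `x ∈ F`. For
`k = 4, 6, 8` Newton's identities turn it into an even polynomial in the exponential sum
`S(a, b) = ∑ x, (-1) ^ Tr (a x ^ (1 + 2 ^ e) + b x)` (`sum_powersetCard_prod_of_sq_eq_one`), so only
the even moments of `S` are needed, and no sign of an exponential sum has to be determined.

These moments come from the quadratic form `x ↦ Tr (a x ^ (1 + 2 ^ e))`. If `R_a` denotes its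
radical, `S(a, b) ^ 2` is either `0` or `q |R_a|` (`expSum_sq_eq_zero_or`), and
`∑ b, S(a, b) ^ 2 = q ^ 2`, which gives `∑ b, S(a, b) ^ (2 j + 2) = q ^ 2 (q |R_a|) ^ j`. For
`a ≠ 0` the radical is zero or a line over `𝔽₁₆`, because `gcd (2 e, m) = 4`; and a nonzero `y` lies
in `R_a` exactly when `a y ^ (1 + 2 ^ e)` lies in `𝔽₄`, because `gcd (e, m) = 2`. Double
counting then gives `∑ a ≠ 0, |R_a| = 4 (q - 1)` (`sum_radCard`), and with it all the moments (`sum_sum_expSum_pow`).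

The dimension is the length of the cyclic code minus the degree of the generator polynomial. The
minimal polynomial of `α` has degree `m`; that of `α ^ (1 + 2 ^ e)` has degree `m` if `m ≥ 8`, and
degree `2` if `m = 4`, where this element lies in `𝔽₄`. The minimum distance is `4`: all weights are
even, weight two would force two labels to coincide, and there are codewords of weight four.
-/

set_option linter.unusedSectionVars false

namespace BinaryCode

/-! ### The trace character -/

section TraceCharacter

variable (F : Type*) [Field F] [Fintype F] [Algebra (ZMod 2) F]

/-- The additive character `x ↦ (-1) ^ Tr x` of a finite field `F` of characteristic two, with
values in `ℚ`. -/
noncomputable def traceChar : AddChar F ℚ :=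
  (AddChar.zmodChar 2 (by norm_num : (-1 : ℚ) ^ 2 = 1)).compAddMonoidHom
    (Algebra.trace (ZMod 2) F).toAddMonoidHom

variable {F}

/-- The trace, hence the trace character, is invariant under Frobenius. -/
theorem traceChar_pow_two_pow (e : ℕ) (x : F) : traceChar F (x ^ 2 ^ e) = traceChar F x := by
  have h : Algebra.trace (ZMod 2) F (x ^ 2 ^ e) = Algebra.trace (ZMod 2) F x := by
    induction e with
    | zero => simp
    | succ e ih =>
      rw [pow_succ, pow_mul, ← ih]
      have := Algebra.trace_eq_of_algEquiv
        (FiniteField.frobeniusAlgEquivOfAlgebraic (ZMod 2) F) (x ^ 2 ^ e)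
      simpa [FiniteField.coe_frobeniusAlgEquivOfAlgebraic, ZMod.card] using this
  simp [traceChar, h]

theorem traceChar_isPrimitive : (traceChar F).IsPrimitive := by
  refine AddChar.IsPrimitive.of_ne_one (AddChar.ne_one_iff.2 ?_)
  obtain ⟨x, hx⟩ := Algebra.trace_surjective (ZMod 2) F 1
  refine ⟨x, ?_⟩
  have h1 : (1 : ZMod 2).val = 1 := rfl
  simp only [traceChar, AddChar.compAddMonoidHom_apply, LinearMap.toAddMonoidHom_coe, hx,
    AddChar.zmodChar_apply, h1]
  norm_num

theorem sum_traceChar_mul [DecidableEq F] (c : F) :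
    ∑ x : F, traceChar F (x * c) = if c = 0 then (Fintype.card F : ℚ) else 0 := by
  rw [AddChar.sum_mulShift c traceChar_isPrimitive]
  split_ifs <;> simp

theorem charTwo_of_algebra (F : Type*) [Field F] [Algebra (ZMod 2) F] : CharP F 2 :=
  charP_of_injective_algebraMap (algebraMap (ZMod 2) F).injective 2

theorem traceChar_sq (x : F) : traceChar F x ^ 2 = 1 := by
  have := charTwo_of_algebra F
  rw [sq, ← AddChar.map_add_eq_mul, CharTwo.add_self_eq_zero, AddChar.map_zero_eq_one]

theorem traceChar_mul_self (x : F) : traceChar F x * traceChar F x = 1 := by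
  rw [← sq, traceChar_sq]

end TraceCharacter

/-! ### The exponential sums `∑ (-1) ^ Tr (a x ^ (1 + 2 ^ e) + b x)` -/

section ExpSum

variable {F : Type*} [Field F] [Fintype F] [Algebra (ZMod 2) F]

/-- The value at `x` of the sign `(-1) ^ Tr (a x ^ (1 + 2 ^ e) + b x)`. -/
noncomputable def signAt (e : ℕ) (a b x : F) : ℚ := traceChar F (a * x ^ (1 + 2 ^ e) + b * x)

/-- The exponential sum `∑ x, (-1) ^ Tr (a x ^ (1 + 2 ^ e) + b x)`. -/
noncomputable def expSum (e : ℕ) (a b : F) : ℚ := ∑ x : F, signAt e a b x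

/-- The linearized polynomial map `y ↦ a y + (a y ^ (2 ^ e)) ^ (2 ^ e)`, which represents the
polarization of the quadratic form `x ↦ Tr (a x ^ (1 + 2 ^ e))`. -/
noncomputable def polarMap (e : ℕ) (a : F) : F →+ F :=
  haveI := charTwo_of_algebra F
  { toFun := fun y => a * y + (a * y ^ 2 ^ e) ^ 2 ^ e
    map_zero' := by simp
    map_add' := fun x y => by
      rw [add_pow_char_pow, mul_add a (x ^ 2 ^ e), add_pow_char_pow]
      ring }

theorem polarMap_apply (e : ℕ) (a y : F) :
    polarMap e a y = a * y + (a * y ^ 2 ^ e) ^ 2 ^ e := rfl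

open scoped Classical in
/-- The number of elements of the radical of the quadratic form `x ↦ Tr (a x ^ (1 + 2 ^ e))`. -/
noncomputable def radCard (e : ℕ) (a : F) : ℕ := Fintype.card (polarMap e a).ker

/-- Polarization of the quadratic form: the cross terms of `a (x + y) ^ (1 + 2 ^ e)` combine,
under the trace, into `Tr (x ^ (2 ^ e) * polarMap e a y)`. -/
theorem signAt_add (e : ℕ) (a b x y : F) :
    signAt e a b (x + y) =
      signAt e a b x * signAt e a b y * traceChar F (x ^ 2 ^ e * polarMap e a y) := by
  have := charTwo_of_algebra F
  have h : a * (x + y) ^ (1 + 2 ^ e) + b * (x + y) =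
      (a * x ^ (1 + 2 ^ e) + b * x) + (a * y ^ (1 + 2 ^ e) + b * y) +
        (x ^ 2 ^ e * (a * y) + x * (a * y ^ 2 ^ e)) := by
    rw [pow_add, add_pow_char_pow]; ring
  have h2 : traceChar F (x ^ 2 ^ e * (a * y) + x * (a * y ^ 2 ^ e)) =
      traceChar F (x ^ 2 ^ e * polarMap e a y) := by
    rw [AddChar.map_add_eq_mul, ← traceChar_pow_two_pow e (x * (a * y ^ 2 ^ e)),
      ← AddChar.map_add_eq_mul, mul_pow x, ← mul_add, ← polarMap_apply]
  rw [signAt, h, AddChar.map_add_eq_mul, AddChar.map_add_eq_mul, h2]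
  rfl

theorem signAt_mul_self (e : ℕ) (a b x : F) : signAt e a b x * signAt e a b x = 1 :=
  traceChar_mul_self _

theorem pow_two_pow_bijective (e : ℕ) : Function.Bijective (fun x : F => x ^ 2 ^ e) := by
  have := charTwo_of_algebra F
  exact bijective_iterateFrobenius F 2 e

open scoped Classical in
/-- Squaring the exponential sum localizes it to the radical. -/
theorem expSum_sq_eq_sum_radical (e : ℕ) (a b : F) :
    expSum e a b ^ 2 =
      Fintype.card F * ∑ y : F, if polarMap e a y = 0 then signAt e a b y else 0 := by
  calc expSum e a b ^ 2 = ∑ x : F, ∑ y : F, signAt e a b x * signAt e a b (x + y) := by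
        rw [sq, expSum, Finset.sum_mul]
        refine Finset.sum_congr rfl fun x _ => ?_
        rw [← Finset.mul_sum]
        congr 1
        exact (Fintype.sum_equiv (Equiv.addLeft x) _ _ fun y => rfl).symm
    _ = ∑ y : F, signAt e a b y * ∑ x : F, traceChar F (x ^ 2 ^ e * polarMap e a y) := by
        rw [Finset.sum_comm]
        refine Finset.sum_congr rfl fun y _ => ?_
        rw [Finset.mul_sum]
        refine Finset.sum_congr rfl fun x _ => ?_
        rw [signAt_add, ← mul_assoc, ← mul_assoc, signAt_mul_self, one_mul]
    _ = _ := by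
        rw [Finset.mul_sum]
        refine Finset.sum_congr rfl fun y _ => ?_
        rw [(pow_two_pow_bijective e).sum_comp (fun x => traceChar F (x * polarMap e a y)),
          sum_traceChar_mul]
        split_ifs <;> ring

open scoped Classical in
/-- On the radical the sign is an additive character, so the square of the exponential sum takes
only the values `0` and `|F| * radCard e a`. -/
theorem expSum_sq_eq_zero_or (e : ℕ) (a b : F) :
    expSum e a b ^ 2 = 0 ∨ expSum e a b ^ 2 = Fintype.card F * radCard e a := by
  let ψ : AddChar (polarMap e a).ker ℚ :=
    { toFun := fun y => signAt e a b y
      map_zero_eq_one' := by simp [signAt]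
      map_add_eq_mul' := fun x y => by
        have hy : polarMap e a y = 0 := y.2
        simp [signAt_add, hy] }
  have h : (∑ y : F, if polarMap e a y = 0 then signAt e a b y else 0) = ∑ y, ψ y := by
    rw [← Finset.sum_filter]
    exact (Finset.sum_subtype _ (fun x => by simp [AddMonoidHom.mem_ker]) _)
  rw [expSum_sq_eq_sum_radical, h, AddChar.sum_eq_ite]
  split_ifs
  · right; rfl
  · left; simp

/-- Parseval's identity in the variable `b`. -/
theorem sum_expSum_sq (e : ℕ) (a : F) :
    ∑ b : F, expSum e a b ^ 2 = (Fintype.card F : ℚ) ^ 2 := by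
  classical
  simp_rw [expSum_sq_eq_sum_radical, ← Finset.mul_sum]
  rw [Finset.sum_comm]
  have h : ∀ y : F, (∑ b : F, if polarMap e a y = 0 then signAt e a b y else 0) =
      if y = 0 then (Fintype.card F : ℚ) else 0 := by
    intro y
    have h2 : ∑ b : F, signAt e a b y = traceChar F (a * y ^ (1 + 2 ^ e)) *
        if y = 0 then (Fintype.card F : ℚ) else 0 := by
      rw [← sum_traceChar_mul, Finset.mul_sum]
      exact Finset.sum_congr rfl fun b _ => AddChar.map_add_eq_mul _ _ _
    by_cases hy : y = 0
    · subst hy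
      simpa using h2
    · rw [if_neg hy, mul_zero] at h2
      split_ifs <;> simp [h2]
  simp_rw [h]
  simp [sq]

/-- Since `expSum e a b ^ 2` is either zero or the constant `|F| * radCard e a`, its second moment
in `b` determines all its higher even moments. -/
theorem sum_expSum_pow (e j : ℕ) (a : F) :
    ∑ b : F, expSum e a b ^ (2 * (j + 1)) =
      (Fintype.card F : ℚ) ^ 2 * (Fintype.card F * radCard e a) ^ j := by
  rw [← sum_expSum_sq e a, Finset.sum_mul]
  refine Finset.sum_congr rfl fun b _ => ?_
  rw [pow_mul, pow_succ']
  rcases expSum_sq_eq_zero_or e a b with h | h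
  · rw [h]; ring
  · rw [h]

end ExpSum

/-! ### Radicals and moments of the exponential sums -/

section Radical

variable {F : Type*} [Field F] [Fintype F] [Algebra (ZMod 2) F]

/-- An element of `𝔽_{2^m}` fixed by the `k`-th power of Frobenius is fixed by the
`gcd k m`-th power. -/
theorem pow_two_pow_eq_self_iff {m : ℕ} (hF : Fintype.card F = 2 ^ m) (k : ℕ) (x : F) :
    x ^ 2 ^ k = x ↔ x ^ 2 ^ Nat.gcd k m = x := by
  rcases eq_or_ne x 0 with rfl | hx
  · simp
  have key : ∀ k : ℕ, x ^ 2 ^ k = x ↔ orderOf x ∣ 2 ^ k - 1 := by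
    intro k
    have h1 : 2 ^ k = 2 ^ k - 1 + 1 := (Nat.sub_add_cancel Nat.one_le_two_pow).symm
    rw [orderOf_dvd_iff_pow_eq_one]
    conv_lhs => rw [h1, pow_succ]
    exact mul_eq_right₀ hx
  have hm : orderOf x ∣ 2 ^ m - 1 := (key m).1 (by rw [← hF, FiniteField.pow_card])
  rw [key, key, ← Nat.pow_sub_one_gcd_pow_sub_one, Nat.dvd_gcd_iff]
  exact (and_iff_left hm).symm

theorem card_filter_pow_eq_one [DecidableEq F] {n : ℕ} (hn : n ∣ Fintype.card F - 1) :
    (Finset.univ.filter fun x : F => x ^ n = 1).card = n := by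
  obtain ⟨g, hg⟩ := IsCyclic.exists_generator (α := Fˣ)
  have hq : Fintype.card F - 1 ≠ 0 := by
    have := Fintype.one_lt_card (α := F)
    omega
  have hn0 : 0 < n := Nat.pos_of_dvd_of_pos hn (Nat.pos_of_ne_zero hq)
  have hprim : IsPrimitiveRoot (g : F) (Fintype.card F - 1) := by
    have h := IsPrimitiveRoot.orderOf g
    rw [orderOf_eq_card_of_forall_mem_zpowers hg, Nat.card_units, Nat.card_eq_fintype_card] at h
    exact IsPrimitiveRoot.coe_units_iff.2 h
  obtain ⟨k, hk⟩ := hn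
  have hζ : IsPrimitiveRoot ((g : F) ^ k) n :=
    hprim.pow (Nat.pos_of_ne_zero hq) (by rw [hk, mul_comm])
  refine (congrArg Finset.card ?_).trans hζ.card_nthRootsFinset
  ext x
  simp [Polynomial.mem_nthRootsFinset hn0]

theorem card_filter_pow_succ_eq_self [DecidableEq F] {n : ℕ} (hn : n ∣ Fintype.card F - 1) :
    (Finset.univ.filter fun x : F => x ^ (n + 1) = x).card = n + 1 := by
  have hn0 : n ≠ 0 := by
    rintro rfl
    have := Fintype.one_lt_card (α := F)
    rw [zero_dvd_iff] at hn
    omega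
  have h : (Finset.univ.filter fun x : F => x ^ (n + 1) = x) =
      insert 0 (Finset.univ.filter fun x : F => x ^ n = 1) := by
    ext x
    rcases eq_or_ne x 0 with rfl | hx
    · simp
    · simp [hx, pow_succ]
  rw [h, Finset.card_insert_of_notMem (by simp [hn0]), card_filter_pow_eq_one hn]

theorem radCard_eq [DecidableEq F] (e : ℕ) (a : F) :
    radCard e a = (Finset.univ.filter fun y : F => polarMap e a y = 0).card := by
  classical
  rw [radCard, Fintype.card_subtype]
  congr 1
  ext y
  simp [AddMonoidHom.mem_ker]

theorem radCard_zero (e : ℕ) : radCard e (0 : F) = Fintype.card F := by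
  classical
  rw [radCard_eq, Finset.filter_true_of_mem, Finset.card_univ]
  simp [polarMap_apply]

theorem polarMap_eq_zero_iff (e : ℕ) (a y : F) :
    polarMap e a y = 0 ↔ (a * y ^ 2 ^ e) ^ 2 ^ e = a * y := by
  have := charTwo_of_algebra F
  rw [polarMap_apply, CharTwo.add_eq_zero, eq_comm]

variable {m e : ℕ}

theorem three_dvd_card_sub_one (hF : Fintype.card F = 2 ^ m) (hm : 4 ∣ m) :
    3 ∣ Fintype.card F - 1 := by
  rw [hF]
  exact (by norm_num : 3 ∣ 2 ^ 4 - 1).trans (Nat.pow_sub_one_dvd_pow_sub_one 2 hm)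

theorem fifteen_dvd_card_sub_one (hF : Fintype.card F = 2 ^ m) (hm : 4 ∣ m) :
    15 ∣ Fintype.card F - 1 := by
  rw [hF]
  exact (by norm_num : 15 ∣ 2 ^ 4 - 1).trans (Nat.pow_sub_one_dvd_pow_sub_one 2 hm)

/-- A nonzero `y` lies in the radical attached to `a ≠ 0` exactly when `a y ^ (1 + 2 ^ e)` is
a nonzero element of the subfield `𝔽₄`. -/
theorem polarMap_eq_zero_iff_pow_three (hF : Fintype.card F = 2 ^ m) (hg : Nat.gcd e m = 2)
    {a y : F} (ha : a ≠ 0) (hy : y ≠ 0) :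
    polarMap e a y = 0 ↔ (a * y ^ (1 + 2 ^ e)) ^ 3 = 1 := by
  have hz : a * y ^ (1 + 2 ^ e) ≠ 0 := mul_ne_zero ha (pow_ne_zero _ hy)
  have h1 : (a * y ^ (1 + 2 ^ e)) ^ 3 = 1 ↔
      (a * y ^ (1 + 2 ^ e)) ^ 2 ^ e = a * y ^ (1 + 2 ^ e) := by
    rw [pow_two_pow_eq_self_iff hF, hg, show 2 ^ 2 = 3 + 1 by rfl, pow_succ _ 3]
    exact (mul_eq_right₀ hz).symm
  rw [polarMap_eq_zero_iff, h1]
  have h2 : (a * y ^ (1 + 2 ^ e)) ^ 2 ^ e = (a * y ^ 2 ^ e) ^ 2 ^ e * y ^ 2 ^ e := by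
    rw [← mul_pow]; ring
  have h3 : a * y ^ (1 + 2 ^ e) = a * y * y ^ 2 ^ e := by ring
  rw [h2, h3]
  exact (mul_left_inj' (pow_ne_zero _ hy)).symm

/-- A nonzero radical is a one-dimensional space over the subfield `𝔽₁₆`. -/
theorem radCard_eq_one_or (hF : Fintype.card F = 2 ^ m) (hm : 4 ∣ m)
    (hg : Nat.gcd (2 * e) m = 4) {a : F} (ha : a ≠ 0) : radCard e a = 1 ∨ radCard e a = 16 := by
  classical
  -- Relative to one nonzero solution `y`, the others are `u * y` with `u ^ 2 ^ (2 * e) = u`.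
  by_cases h : ∃ y, y ≠ 0 ∧ polarMap e a y = 0
  · right
    obtain ⟨y, hy, hy0⟩ := h
    rw [polarMap_eq_zero_iff] at hy0
    have key : ∀ u : F, polarMap e a (u * y) = 0 ↔ u ^ (15 + 1) = u := by
      intro u
      rw [polarMap_eq_zero_iff, show 15 + 1 = 2 ^ 4 by norm_num, ← hg,
        ← pow_two_pow_eq_self_iff hF]
      have h1 : (a * (u * y) ^ 2 ^ e) ^ 2 ^ e = u ^ 2 ^ (2 * e) * (a * y) := by
        rw [← hy0]; ring
      rw [h1, show a * (u * y) = u * (a * y) by ring]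
      exact mul_left_inj' (mul_ne_zero ha hy)
    rw [radCard_eq]
    refine Eq.trans (Eq.symm (Finset.card_bij (fun u _ => u * y) ?_ ?_ ?_))
      (card_filter_pow_succ_eq_self (fifteen_dvd_card_sub_one hF hm))
    · intro u hu
      simpa [key] using hu
    · intro u _ v _ huv
      exact mul_right_cancel₀ hy huv
    · intro v hv
      refine ⟨v / y, ?_, div_mul_cancel₀ v hy⟩
      simp only [Finset.mem_filter, Finset.mem_univ, true_and] at hv ⊢
      rw [← key, div_mul_cancel₀ v hy]
      exact hv
  · left
    push Not at h
    rw [radCard_eq, Finset.card_eq_one]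
    refine ⟨0, ?_⟩
    ext y
    simp only [Finset.mem_filter, Finset.mem_univ, true_and, Finset.mem_singleton]
    exact ⟨fun hy => by_contra fun hy0 => h y hy0 hy, fun hy => by simp [hy]⟩

open scoped Classical in
/-- The total size of the radicals: each nonzero `y` lies in the radicals attached to exactly
three nonzero `a`. -/
theorem sum_radCard (hF : Fintype.card F = 2 ^ m) (hm : 4 ∣ m) (hg : Nat.gcd e m = 2) :
    ∑ a ∈ Finset.univ.erase (0 : F), radCard e a = 4 * (Fintype.card F - 1) := by
  have hcard : (Finset.univ.erase (0 : F)).card = Fintype.card F - 1 := by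
    rw [Finset.card_erase_of_mem (Finset.mem_univ _), Finset.card_univ]
  simp_rw [radCard_eq, Finset.card_filter]
  rw [Finset.sum_comm, ← Finset.add_sum_erase _ _ (Finset.mem_univ (0 : F))]
  have h : ∀ y ∈ Finset.univ.erase (0 : F),
      (∑ a ∈ Finset.univ.erase (0 : F), if polarMap e a y = 0 then 1 else 0) = 3 := by
    intro y hy
    have hy := Finset.ne_of_mem_erase hy
    rw [← Finset.card_filter, ← card_filter_pow_eq_one (three_dvd_card_sub_one hF hm)]
    have hy' : y ^ (1 + 2 ^ e) ≠ 0 := pow_ne_zero _ hy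
    refine Finset.card_bij (fun a _ => a * y ^ (1 + 2 ^ e)) ?_ ?_ ?_
    · intro a ha
      simp only [Finset.mem_filter, Finset.mem_erase, Finset.mem_univ, and_true, true_and] at ha ⊢
      exact (polarMap_eq_zero_iff_pow_three hF hg ha.1 hy).1 ha.2
    · intro a _ b _ hab
      exact mul_right_cancel₀ hy' hab
    · intro z hz
      simp only [Finset.mem_filter, Finset.mem_univ, true_and] at hz
      have hz0 : z ≠ 0 := by rintro rfl; simp at hz
      have ha : z / y ^ (1 + 2 ^ e) ≠ 0 := div_ne_zero hz0 hy'
      refine ⟨z / y ^ (1 + 2 ^ e), ?_, div_mul_cancel₀ z hy'⟩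
      simp only [Finset.mem_filter, Finset.mem_erase, Finset.mem_univ, and_true]
      rw [polarMap_eq_zero_iff_pow_three hF hg ha hy, div_mul_cancel₀ z hy']
      exact ⟨ha, hz⟩
  rw [Finset.sum_congr rfl h]
  simp [hcard]
  ring

/-- The even moments of the family of exponential sums. -/
theorem sum_sum_expSum_pow (hF : Fintype.card F = 2 ^ m) (hm : 4 ∣ m) (hg : Nat.gcd e m = 2)
    (hg' : Nat.gcd (2 * e) m = 4) (j : ℕ) :
    ∑ a : F, ∑ b : F, expSum e a b ^ (2 * (j + 1)) =
      (Fintype.card F : ℚ) ^ (j + 2) *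
        ((Fintype.card F : ℚ) ^ j + (Fintype.card F - 1) * (1 + (16 ^ j - 1) / 5)) := by
  classical
  -- As `radCard e a` is `1` or `16`, its powers are affine functions of it.
  have h0 : ∀ a ∈ Finset.univ.erase (0 : F),
      (radCard e a : ℚ) ^ j = (1 - (16 ^ j - 1) / 15) + (16 ^ j - 1) / 15 * radCard e a := by
    intro a ha
    rcases radCard_eq_one_or hF hm hg' (Finset.ne_of_mem_erase ha) with h | h <;>
    · rw [h]; push_cast; ring
  have h1 : (∑ a ∈ Finset.univ.erase (0 : F), (radCard e a : ℚ)) = 4 * (Fintype.card F - 1) := by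
    rw [← Nat.cast_sum, sum_radCard hF hm hg]
    rw [Nat.cast_mul, Nat.cast_sub Fintype.card_pos]
    simp
  have h2 : (∑ a : F, (radCard e a : ℚ) ^ j) =
      (Fintype.card F : ℚ) ^ j + (Fintype.card F - 1) * (1 + (16 ^ j - 1) / 5) := by
    rw [← Finset.add_sum_erase _ _ (Finset.mem_univ (0 : F)), radCard_zero,
      Finset.sum_congr rfl h0, Finset.sum_add_distrib, ← Finset.mul_sum, h1, Finset.sum_const,
      Finset.card_erase_of_mem (Finset.mem_univ _), Finset.card_univ, nsmul_eq_mul,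
      Nat.cast_sub Fintype.card_pos]
    push_cast
    ring
  simp_rw [sum_expSum_pow, ← Finset.mul_sum, mul_pow, ← Finset.mul_sum, h2]
  ring

end Radical

/-! ### Elementary symmetric functions of signs -/

section Newton

variable {σ : Type*} [Fintype σ]

/-- Newton's identities for a family of signs, whose power sums depend only on the parity of the
exponent: the elementary symmetric functions of degrees four, six and eight are even
polynomials in the sum `s`. -/
theorem sum_powersetCard_prod_of_sq_eq_one (f : σ → ℚ) (hf : ∀ i, f i ^ 2 = 1) {s n : ℚ}
    (hs : ∑ i, f i = s) (hn : (Fintype.card σ : ℚ) = n) :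
    ∑ W ∈ Finset.powersetCard 4 Finset.univ, ∏ i ∈ W, f i =
      (s ^ 4 + (8 - 6 * n) * s ^ 2 + 3 * n ^ 2 - 6 * n) / 24 ∧
    ∑ W ∈ Finset.powersetCard 6 Finset.univ, ∏ i ∈ W, f i =
      (s ^ 6 + (40 - 15 * n) * s ^ 4 + (45 * n ^ 2 - 210 * n + 184) * s ^ 2
        - 15 * n ^ 3 + 90 * n ^ 2 - 120 * n) / 720 ∧
    ∑ W ∈ Finset.powersetCard 8 Finset.univ, ∏ i ∈ W, f i =
      (s ^ 8 + (112 - 28 * n) * s ^ 6 + (210 * n ^ 2 - 1540 * n + 2464) * s ^ 4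
        + (-420 * n ^ 3 + 4200 * n ^ 2 - 11872 * n + 8448) * s ^ 2
        + 105 * n ^ 4 - 1260 * n ^ 3 + 4620 * n ^ 2 - 5040 * n) / 40320 := by
  classical
  have hpar : ∀ j : ℕ, (∑ i, f i ^ (2 * j) = n) ∧ ∑ i, f i ^ (2 * j + 1) = s := by
    intro j
    simp [pow_succ, pow_mul, hf, hs, hn]
  set E : ℕ → ℚ := fun k => ∑ W ∈ Finset.powersetCard k Finset.univ, ∏ i ∈ W, f i with hE
  have hN : ∀ k : ℕ, (k : ℚ) * E k =
      (-1) ^ (k + 1) * ∑ j ∈ Finset.range k, (-1) ^ j * E j * ∑ i, f i ^ (k - j) := by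
    intro k
    have h := congrArg (MvPolynomial.aeval f) (MvPolynomial.mul_esymm_eq_sum σ ℚ k)
    rw [Finset.sum_filter, Finset.Nat.sum_antidiagonal_eq_sum_range_succ_mk,
      Finset.sum_range_succ] at h
    simp only [lt_irrefl, if_false, add_zero] at h
    rw [Finset.sum_congr rfl (fun j hj => if_pos (Finset.mem_range.1 hj))] at h
    simpa [MvPolynomial.esymm, MvPolynomial.psum, map_sum, map_prod] using h
  have h0 : E 0 = 1 := by simp [hE]
  change E 4 = _ ∧ E 6 = _ ∧ E 8 = _
  have p1 : ∑ i, f i ^ 1 = s := (hpar 0).2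
  have p2 : ∑ i, f i ^ 2 = n := (hpar 1).1
  have p3 : ∑ i, f i ^ 3 = s := (hpar 1).2
  have p4 : ∑ i, f i ^ 4 = n := (hpar 2).1
  have p5 : ∑ i, f i ^ 5 = s := (hpar 2).2
  have p6 : ∑ i, f i ^ 6 = n := (hpar 3).1
  have p7 : ∑ i, f i ^ 7 = s := (hpar 3).2
  have p8 : ∑ i, f i ^ 8 = n := (hpar 4).1
  have e1 : E 1 = s := by
    have h := hN 1
    simp only [Finset.sum_range_succ, Finset.sum_range_zero, Nat.sub_zero, h0, p1] at h
    push_cast at h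
    linear_combination h / 1
  have e2 : E 2 = (s ^ 2 - n) / 2 := by
    have h := hN 2
    simp only [Finset.sum_range_succ, Finset.sum_range_zero, Nat.reduceSub, Nat.sub_zero,
      h0, e1, p1, p2] at h
    push_cast at h
    linear_combination h / 2
  have e3 : E 3 = (s ^ 3 + (2 - 3 * n) * s) / 6 := by
    have h := hN 3
    simp only [Finset.sum_range_succ, Finset.sum_range_zero, Nat.reduceSub, Nat.sub_zero,
      h0, e1, e2, p1, p2, p3] at h
    push_cast at h
    linear_combination h / 3
  have e4 : E 4 = (s ^ 4 + (8 - 6 * n) * s ^ 2 + 3 * n ^ 2 - 6 * n) / 24 := by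
    have h := hN 4
    simp only [Finset.sum_range_succ, Finset.sum_range_zero, Nat.reduceSub, Nat.sub_zero,
      h0, e1, e2, e3, p1, p2, p3, p4] at h
    push_cast at h
    linear_combination h / 4
  have e5 : E 5 = (s ^ 5 + (20 - 10 * n) * s ^ 3 + (15 * n ^ 2 - 50 * n + 24) * s) / 120 := by
    have h := hN 5
    simp only [Finset.sum_range_succ, Finset.sum_range_zero, Nat.reduceSub, Nat.sub_zero,
      h0, e1, e2, e3, e4, p1, p2, p3, p4, p5] at h
    push_cast at h
    linear_combination h / 5
  have e6 : E 6 = (s ^ 6 + (40 - 15 * n) * s ^ 4 + (45 * n ^ 2 - 210 * n + 184) * s ^ 2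
        - 15 * n ^ 3 + 90 * n ^ 2 - 120 * n) / 720 := by
    have h := hN 6
    simp only [Finset.sum_range_succ, Finset.sum_range_zero, Nat.reduceSub, Nat.sub_zero,
      h0, e1, e2, e3, e4, e5, p1, p2, p3, p4, p5, p6] at h
    push_cast at h
    linear_combination h / 6
  have e7 : E 7 = (s ^ 7 + (70 - 21 * n) * s ^ 5 + (105 * n ^ 2 - 630 * n + 784) * s ^ 3
        + (-105 * n ^ 3 + 840 * n ^ 2 - 1764 * n + 720) * s) / 5040 := by
    have h := hN 7
    simp only [Finset.sum_range_succ, Finset.sum_range_zero, Nat.reduceSub, Nat.sub_zero,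
      h0, e1, e2, e3, e4, e5, e6, p1, p2, p3, p4, p5, p6, p7] at h
    push_cast at h
    linear_combination h / 7
  have e8 : E 8 = (s ^ 8 + (112 - 28 * n) * s ^ 6 + (210 * n ^ 2 - 1540 * n + 2464) * s ^ 4
        + (-420 * n ^ 3 + 4200 * n ^ 2 - 11872 * n + 8448) * s ^ 2
        + 105 * n ^ 4 - 1260 * n ^ 3 + 4620 * n ^ 2 - 5040 * n) / 40320 := by
    have h := hN 8
    simp only [Finset.sum_range_succ, Finset.sum_range_zero, Nat.reduceSub, Nat.sub_zero,
      h0, e1, e2, e3, e4, e5, e6, e7, p1, p2, p3, p4, p5, p6, p7, p8] at h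
    push_cast at h
    linear_combination h / 8
  exact ⟨e4, e6, e8⟩

end Newton

/-! ### Counting the supports of codewords -/

section Supports

variable {F : Type*} [Field F] [Fintype F] [Algebra (ZMod 2) F]

open scoped Classical in
/-- The `k`-element subsets of `F` on which `x` and `x ^ (1 + 2 ^ e)` both sum to zero. -/
noncomputable def zeroSumSets (F : Type*) [Field F] [Fintype F] (e k : ℕ) : Finset (Finset F) :=
  (Finset.powersetCard k Finset.univ).filter fun W =>
    ∑ x ∈ W, x = 0 ∧ ∑ x ∈ W, x ^ (1 + 2 ^ e) = 0

theorem addChar_sum_eq_prod {ι A M : Type*} [AddCommMonoid A] [CommMonoid M] (ψ : AddChar A M)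
    (s : Finset ι) (f : ι → A) : ψ (∑ i ∈ s, f i) = ∏ i ∈ s, ψ (f i) := by
  classical
  induction s using Finset.induction_on with
  | empty => simp
  | insert i s hi ih => rw [Finset.sum_insert hi, Finset.prod_insert hi, ψ.map_add_eq_mul, ih]

/-- Orthogonality of characters: zero-sum sets are counted by elementary symmetric functions of
the signs. -/
theorem card_sq_mul_card_zeroSumSets (e k : ℕ) :
    (Fintype.card F : ℚ) ^ 2 * (zeroSumSets F e k).card =
      ∑ a : F, ∑ b : F, ∑ W ∈ Finset.powersetCard k (Finset.univ : Finset F),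
        ∏ x ∈ W, signAt e a b x := by
  classical
  have h : ∀ W : Finset F, ∑ a : F, ∑ b : F, ∏ x ∈ W, signAt e a b x =
      if ∑ x ∈ W, x = 0 ∧ ∑ x ∈ W, x ^ (1 + 2 ^ e) = 0 then (Fintype.card F : ℚ) ^ 2 else 0 := by
    intro W
    have h1 : ∀ a b : F, ∏ x ∈ W, signAt e a b x =
        traceChar F (a * ∑ x ∈ W, x ^ (1 + 2 ^ e)) * traceChar F (b * ∑ x ∈ W, x) := by
      intro a b
      rw [Finset.mul_sum, Finset.mul_sum, addChar_sum_eq_prod, addChar_sum_eq_prod,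
        ← Finset.prod_mul_distrib]
      exact Finset.prod_congr rfl fun x _ => AddChar.map_add_eq_mul _ _ _
    simp_rw [h1, ← Finset.mul_sum, ← Finset.sum_mul, sum_traceChar_mul]
    by_cases h2 : ∑ x ∈ W, x = 0 <;> by_cases h3 : ∑ x ∈ W, x ^ (1 + 2 ^ e) = 0 <;>
      simp [h2, h3, sq]
  have h4 : ∑ a : F, ∑ b : F, ∑ W ∈ Finset.powersetCard k (Finset.univ : Finset F),
        ∏ x ∈ W, signAt e a b x = ∑ W ∈ Finset.powersetCard k (Finset.univ : Finset F),
          ∑ a : F, ∑ b : F, ∏ x ∈ W, signAt e a b x := by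
    rw [Finset.sum_comm]
    refine (Finset.sum_congr rfl fun b _ => Finset.sum_comm).trans ?_
    rw [Finset.sum_comm]
    exact Finset.sum_congr rfl fun W _ => Finset.sum_comm
  rw [h4, Finset.sum_congr rfl fun W _ => h W, ← Finset.sum_filter, Finset.sum_const,
    nsmul_eq_mul, mul_comm]
  congr! 3

/-- The numbers of zero-sum sets of sizes four, six and eight in a field with `q` elements. -/
theorem card_zeroSumSets {m e : ℕ} (hF : Fintype.card F = 2 ^ m) (hm : 4 ∣ m)
    (hg : Nat.gcd e m = 2) (hg' : Nat.gcd (2 * e) m = 4) {q : ℚ} (hq : (Fintype.card F : ℚ) = q) :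
    ((zeroSumSets F e 4).card : ℚ) = q * (q - 1) / 12 ∧
    ((zeroSumSets F e 6).card : ℚ) = q * (q - 1) * (q ^ 2 / 16 + q / 2 + 6) / 45 ∧
    ((zeroSumSets F e 8).card : ℚ) = q / 8 * (q - 1) *
      (q ^ 4 / 16 - 27 * (q ^ 3 / 16) + 23 * (q ^ 2 / 2) + 261 * (q / 4) + 403) / 315 := by
  have hq0 : q ^ 2 ≠ 0 := by
    rw [← hq]
    exact pow_ne_zero _ (Nat.cast_ne_zero.2 Fintype.card_ne_zero)
  have hE := fun a b : F => sum_powersetCard_prod_of_sq_eq_one (signAt e a b)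
    (fun x => traceChar_sq _) (s := expSum e a b) rfl hq
  -- Every elementary symmetric function is an even polynomial in the exponential sum, so its
  -- average is a combination of the even moments.
  have hM := fun j => sum_sum_expSum_pow (F := F) hF hm hg hg' j
  have M2 := hM 0
  have M4 := hM 1
  have M6 := hM 2
  have M8 := hM 3
  have C4 := card_sq_mul_card_zeroSumSets (F := F) e 4
  have C6 := card_sq_mul_card_zeroSumSets (F := F) e 6
  have C8 := card_sq_mul_card_zeroSumSets (F := F) e 8
  simp only [hq, fun a b => (hE a b).1, fun a b => (hE a b).2.1, fun a b => (hE a b).2.2,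
    ← Finset.sum_div, Finset.sum_add_distrib, Finset.sum_sub_distrib, ← Finset.mul_sum,
    Finset.sum_const, Finset.card_univ, nsmul_eq_mul] at M2 M4 M6 M8 C4 C6 C8
  norm_num at M2 M4 M6 M8 C4 C6 C8
  simp only [M2, M4, M6, M8] at C4 C6 C8
  refine ⟨mul_left_cancel₀ hq0 (C4.trans ?_), mul_left_cancel₀ hq0 (C6.trans ?_),
    mul_left_cancel₀ hq0 (C8.trans ?_)⟩ <;> ring

end Supports

/-! ### Cyclic codes and polynomials -/

section Code

variable {F : Type*} [Field F] [Fintype F] [Algebra (ZMod 2) F]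

/-- When `g` divides `X ^ n - 1`, membership in the ideal generated by `g` modulo `X ^ n - 1` is
divisibility by `g`. -/
theorem mem_cyclicCode_iff {n : ℕ} {g : (ZMod 2)[X]} (hg : g ∣ X ^ n - 1)
    (c : Fin n → ZMod 2) : c ∈ cyclicCode n g ↔ g ∣ wordPoly n c := by
  have h : c ∈ cyclicCode n g ↔
      Ideal.Quotient.mk (Ideal.span {(X ^ n - 1 : (ZMod 2)[X])}) (wordPoly n c) ∈
        Ideal.span {Ideal.Quotient.mk (Ideal.span {(X ^ n - 1 : (ZMod 2)[X])}) g} := Iff.rfl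
  rw [h, Ideal.mem_span_singleton]
  constructor
  · rintro ⟨u, hu⟩
    obtain ⟨u, rfl⟩ := Ideal.Quotient.mk_surjective u
    rw [← map_mul, Ideal.Quotient.eq, Ideal.mem_span_singleton] at hu
    exact (dvd_sub_left (Dvd.intro u rfl)).1 (hg.trans hu)
  · exact fun hd => map_dvd _ hd

theorem aeval_wordPoly (n : ℕ) (c : Fin n → ZMod 2) (x : F) :
    aeval x (wordPoly n c) = ∑ i, c i • x ^ (i : ℕ) := by
  simp [wordPoly, aeval_monomial, Algebra.smul_def]

theorem genPoly_singleton (α : F) (e : ℕ) :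
    genPoly α {e} = minpoly (ZMod 2) α * minpoly (ZMod 2) (α ^ (1 + 2 ^ e)) := by
  have h : (minpoly (ZMod 2) (α ^ (1 + 2 ^ e))).Monic := minpoly.monic (.of_finite _ _)
  simp only [genPoly, polyLcm, Finset.lcm_singleton]
  congr 1
  exact h.normalize_eq_self

end Code

/-! ### Arithmetic of the exponents -/

section Exponents

/-- For `m` divisible by four and `gcd m e = 2`, the half of `e` is odd. -/
theorem exponent_arith {m e : ℕ} (hm : 4 ∣ m) (hgcd : Nat.gcd m e = 2) :
    Nat.gcd (2 * e) m = 4 ∧ e % 4 = 2 := by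
  obtain ⟨k, rfl⟩ := hm
  have he : 2 ∣ e := hgcd ▸ Nat.gcd_dvd_right _ _
  have he4 : ¬ 4 ∣ e := fun h => by
    have := Nat.dvd_gcd (Dvd.intro k rfl) h
    rw [hgcd] at this
    omega
  refine ⟨?_, by omega⟩
  obtain ⟨f, rfl⟩ := he
  have h1 : Nat.gcd (2 * k) f = 1 := by
    rw [show 4 * k = 2 * (2 * k) by ring, Nat.gcd_mul_left] at hgcd
    omega
  have h2 : Nat.gcd f k = 1 := Nat.Coprime.symm (Nat.Coprime.coprime_mul_left h1)
  rw [show 2 * (2 * f) = 4 * f by ring, Nat.gcd_mul_left, h2]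

theorem five_dvd_two_pow_add_one {e : ℕ} (he : e % 4 = 2) : 5 ∣ 1 + 2 ^ e := by
  have h : 2 ^ e = 16 ^ (e / 4) * 4 := by
    conv_lhs => rw [← Nat.div_add_mod e 4, he, pow_add, pow_mul]
    norm_num
  have h16 : 16 ^ (e / 4) % 5 = 1 := by simp [Nat.pow_mod]
  omega

theorem fifteen_dvd_two_pow_sub_one {m : ℕ} (hm : 4 ∣ m) : 15 ∣ 2 ^ m - 1 :=
  (by norm_num : 15 ∣ 2 ^ 4 - 1).trans (Nat.pow_sub_one_dvd_pow_sub_one 2 hm)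

/-- The power `α ^ (1 + 2 ^ e)` of a primitive element lies in no proper subfield once `8 ≤ m`. -/
theorem eq_of_dvd_mul_two_pow_sub_one {m e d : ℕ} (hm : 8 ≤ m) (hg : Nat.gcd (2 * e) m = 4)
    (hd : d ∣ m) (h : 2 ^ m - 1 ∣ (1 + 2 ^ e) * (2 ^ d - 1)) : d = m := by
  by_contra hne
  obtain ⟨k, rfl⟩ := hd
  have hd0 : 0 < d := Nat.pos_of_ne_zero (by rintro rfl; omega)
  have hk : 2 ≤ k := by
    rcases k with _ | _ | k
    · omega
    · omega
    · omega
  have hdm : 2 * d ≤ d * k := by nlinarith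
  -- Multiplying by `2 ^ e - 1` turns the factor `1 + 2 ^ e` into `2 ^ (2 e) - 1`, whose common
  -- divisor with `2 ^ m - 1` is `15`.
  have h1 : 2 ^ (d * k) - 1 ∣ (2 ^ (2 * e) - 1) * (2 ^ d - 1) := by
    have h2 : 2 ^ (2 * e) - 1 = (1 + 2 ^ e) * (2 ^ e - 1) := by
      rw [mul_comm 2 e, pow_mul, add_comm]
      simpa using Nat.sq_sub_sq (2 ^ e) 1
    rw [h2, mul_right_comm]
    exact h.mul_right _
  have h3 : 2 ^ (d * k) - 1 ∣ 15 * (2 ^ d - 1) := by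
    have h4 := Nat.dvd_gcd h1 (Dvd.intro (2 ^ d - 1) rfl : 2 ^ (d * k) - 1 ∣ _)
    rwa [Nat.gcd_mul_right, Nat.pow_sub_one_gcd_pow_sub_one, hg] at h4
  have hpos : 0 < 2 ^ d - 1 := by
    have := Nat.one_lt_two_pow hd0.ne'
    omega
  have h5 := Nat.le_of_dvd (by positivity) h3
  rcases le_or_gt d 3 with hd3 | hd3
  · have h6 : 2 ^ d ≤ 2 ^ 3 := Nat.pow_le_pow_right (by norm_num) hd3
    have h7 : 2 ^ 8 ≤ 2 ^ (d * k) := Nat.pow_le_pow_right (by norm_num) hm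
    omega
  · have h6 : 2 ^ 4 ≤ 2 ^ d := Nat.pow_le_pow_right (by norm_num) hd3
    have h7 : 2 ^ (2 * d) ≤ 2 ^ (d * k) := Nat.pow_le_pow_right (by norm_num) hdm
    have h8 : 2 ^ (2 * d) = 2 ^ d * 2 ^ d := by rw [two_mul, pow_add]
    have h9 : 16 * 2 ^ d ≤ 2 ^ d * 2 ^ d := Nat.mul_le_mul_right _ h6
    omega

end Exponents

/-! ### The generator polynomial -/

section MinimalPolynomials

variable {F : Type*} [Field F] [Fintype F] [Algebra (ZMod 2) F] {m e : ℕ} {α : F}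

theorem finrank_eq (hF : Fintype.card F = 2 ^ m) : Module.finrank (ZMod 2) F = m := by
  have h := Module.card_eq_pow_finrank (K := ZMod 2) (V := F)
  rw [hF, ZMod.card] at h
  exact (Nat.pow_right_injective le_rfl h).symm

theorem natDegree_minpoly_dvd (hF : Fintype.card F = 2 ^ m) (x : F) :
    (minpoly (ZMod 2) x).natDegree ∣ m := by
  rw [← finrank_eq hF]
  exact minpoly.degree_dvd (.of_finite _ _)

/-- Every element lies in the field with `2 ^ d` elements, `d` the degree of its minimal
polynomial. -/
theorem pow_two_pow_natDegree_minpoly (x : F) :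
    x ^ 2 ^ (minpoly (ZMod 2) x).natDegree = x := by
  classical
  let K := IntermediateField.adjoin (ZMod 2) {x}
  let y : K := IntermediateField.AdjoinSimple.gen (ZMod 2) x
  have h := Module.card_eq_pow_finrank (K := ZMod 2) (V := K)
  rw [IntermediateField.adjoin.finrank (.of_finite _ _), ZMod.card] at h
  have hy : y ^ Fintype.card K = y := FiniteField.pow_card y
  rw [h] at hy
  exact congrArg Subtype.val hy

theorem natDegree_minpoly_primitive (hF : Fintype.card F = 2 ^ m) (hm : m ≠ 0)
    (hα : IsPrimitiveRoot α (2 ^ m - 1)) : (minpoly (ZMod 2) α).natDegree = m := by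
  have hα0 : α ≠ 0 := hα.ne_zero (by have := Nat.one_lt_two_pow hm; omega)
  refine Nat.dvd_antisymm (natDegree_minpoly_dvd hF α) ?_
  set d := (minpoly (ZMod 2) α).natDegree
  have h1 : α ^ (2 ^ d - 1) = 1 := by
    have h := pow_two_pow_natDegree_minpoly α
    rwa [← Nat.sub_add_cancel (Nat.one_le_two_pow (n := d)), pow_succ, mul_eq_right₀ hα0] at h
  have h2 := Nat.gcd_eq_left ((hα.pow_eq_one_iff_dvd _).1 h1)
  rw [Nat.pow_sub_one_gcd_pow_sub_one] at h2
  have h3 : 2 ^ Nat.gcd m d = 2 ^ m := by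
    have := Nat.one_le_two_pow (n := m)
    have := Nat.one_le_two_pow (n := Nat.gcd m d)
    omega
  exact Nat.gcd_eq_left_iff_dvd.1 (Nat.pow_right_injective le_rfl h3)

theorem natDegree_minpoly_pow (hF : Fintype.card F = 2 ^ m) (hm : 8 ≤ m)
    (hg : Nat.gcd (2 * e) m = 4) (hα : IsPrimitiveRoot α (2 ^ m - 1)) :
    (minpoly (ZMod 2) (α ^ (1 + 2 ^ e))).natDegree = m := by
  have hα0 : α ≠ 0 := hα.ne_zero (by have := Nat.one_lt_two_pow (n := m) (by omega); omega)
  refine eq_of_dvd_mul_two_pow_sub_one hm hg (natDegree_minpoly_dvd hF _) ?_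
  have h := pow_two_pow_natDegree_minpoly (α ^ (1 + 2 ^ e))
  set d := (minpoly (ZMod 2) (α ^ (1 + 2 ^ e))).natDegree
  rw [← Nat.sub_add_cancel (Nat.one_le_two_pow (n := d)), pow_succ,
    mul_eq_right₀ (pow_ne_zero _ hα0), ← pow_mul] at h
  exact (hα.pow_eq_one_iff_dvd _).1 h

/-- In `𝔽₁₆` the element `α ^ 5` generates the subfield `𝔽₄`. -/
theorem natDegree_minpoly_pow_five (hα : IsPrimitiveRoot α 15) :
    (minpoly (ZMod 2) (α ^ 5)).natDegree = 2 := by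
  have h3 : IsPrimitiveRoot (α ^ 5) 3 := hα.pow (by norm_num) (by norm_num)
  have hle : (minpoly (ZMod 2) (α ^ 5)).natDegree ≤ 2 := by
    have hdeg : (X ^ 2 + X + 1 : (ZMod 2)[X]).natDegree = 2 := by compute_degree!
    refine (Polynomial.natDegree_le_of_dvd (minpoly.dvd _ _ ?_) (by
      intro h; rw [h] at hdeg; simp at hdeg)).trans hdeg.le
    have h1 : (α ^ 5 - 1) * ((α ^ 5) ^ 2 + α ^ 5 + 1) = 0 := by
      linear_combination h3.pow_eq_one
    simpa using (mul_eq_zero.1 h1).resolve_left (sub_ne_zero.2 (h3.ne_one (by norm_num)))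
  have h1 := pow_two_pow_natDegree_minpoly (α ^ 5)
  have hpos := minpoly.natDegree_pos (A := ZMod 2) (x := α ^ 5) (.of_finite _ _)
  interval_cases (minpoly (ZMod 2) (α ^ 5)).natDegree
  · exfalso
    have h0 : α ^ 5 ≠ 0 := h3.ne_zero (by norm_num)
    refine h3.ne_one (by norm_num) ?_
    rwa [pow_one, sq, mul_eq_left₀ h0] at h1
  · rfl

/-- The two minimal polynomials are distinct: `α ^ (1 + 2 ^ e)` is a fifth power, hence not
primitive. -/
theorem isCoprime_minpoly (hm0 : m ≠ 0) (hm : 4 ∣ m) (he : e % 4 = 2)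
    (hα : IsPrimitiveRoot α (2 ^ m - 1)) :
    IsCoprime (minpoly (ZMod 2) α) (minpoly (ZMod 2) (α ^ (1 + 2 ^ e))) := by
  rw [(minpoly.irreducible (.of_finite (ZMod 2) α)).coprime_iff_not_dvd]
  intro h
  obtain ⟨k, hk⟩ := (by norm_num : 5 ∣ 15).trans (fifteen_dvd_two_pow_sub_one hm)
  obtain ⟨l, hl⟩ := five_dvd_two_pow_add_one he
  have h1 : minpoly (ZMod 2) (α ^ (1 + 2 ^ e)) ∣ X ^ k - 1 := by
    refine minpoly.dvd _ _ ?_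
    have : (α ^ (1 + 2 ^ e)) ^ k = 1 := by
      rw [← pow_mul, hl, mul_right_comm, ← hk, pow_mul, hα.pow_eq_one, one_pow]
    simp [this]
  have h2 : α ^ k = 1 := by
    have := aeval_eq_zero_of_dvd_aeval_eq_zero (h.trans h1) (minpoly.aeval _ _)
    simpa [sub_eq_zero] using this
  have h3 := (hα.pow_eq_one_iff_dvd _).1 h2
  have := Nat.one_lt_two_pow hm0
  have := Nat.le_of_dvd (by omega) h3
  omega

theorem genPoly_monic (α : F) (e : ℕ) : (genPoly α {e}).Monic := by
  rw [genPoly_singleton]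
  exact (minpoly.monic (.of_finite _ _)).mul (minpoly.monic (.of_finite _ _))

theorem genPoly_dvd_iff (hm0 : m ≠ 0) (hm : 4 ∣ m) (he : e % 4 = 2)
    (hα : IsPrimitiveRoot α (2 ^ m - 1)) (f : (ZMod 2)[X]) :
    genPoly α {e} ∣ f ↔ aeval α f = 0 ∧ aeval (α ^ (1 + 2 ^ e)) f = 0 := by
  rw [genPoly_singleton, ← minpoly.dvd_iff, ← minpoly.dvd_iff]
  exact ⟨fun h => ⟨dvd_of_mul_right_dvd h, dvd_of_mul_left_dvd h⟩,
    fun h => (isCoprime_minpoly hm0 hm he hα).mul_dvd h.1 h.2⟩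

theorem genPoly_dvd_X_pow_sub_one (hm0 : m ≠ 0) (hm : 4 ∣ m) (he : e % 4 = 2)
    (hα : IsPrimitiveRoot α (2 ^ m - 1)) : genPoly α {e} ∣ X ^ (2 ^ m - 1) - 1 := by
  rw [genPoly_dvd_iff hm0 hm he hα]
  have h : (α ^ (1 + 2 ^ e)) ^ (2 ^ m - 1) = 1 := by rw [pow_right_comm, hα.pow_eq_one, one_pow]
  simp [hα.pow_eq_one, h]

end MinimalPolynomials

/-! ### Dimensions -/

section Dimension

theorem wordPoly_coeff {n : ℕ} {f : (ZMod 2)[X]} (hf : f.natDegree < n) :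
    wordPoly n (fun i => f.coeff i) = f := by
  conv_rhs => rw [f.as_sum_range' n hf, Finset.sum_range]
  simp [wordPoly]

/-- The words of the cyclic code form the kernel of the reduction map onto `𝔽₂[X] / (g)`. -/
theorem finrank_cyclicCode {n : ℕ} (hn : n ≠ 0) {g : (ZMod 2)[X]} (hmon : g.Monic)
    (hg : g ∣ X ^ n - 1) : Module.finrank (ZMod 2) (cyclicCode n g) = n - g.natDegree := by
  let L : (Fin n → ZMod 2) →ₗ[ZMod 2] AdjoinRoot g :=
    (AdjoinRoot.mkₐ g).toLinearMap ∘ₗ wordPoly n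
  have hker : LinearMap.ker L = cyclicCode n g := by
    ext c
    rw [LinearMap.mem_ker, mem_cyclicCode_iff hg]
    exact AdjoinRoot.mk_eq_zero
  have hdeg : g.natDegree ≤ n := by
    have h := Polynomial.natDegree_le_of_dvd hg (X_pow_sub_C_ne_zero (Nat.pos_of_ne_zero hn) 1)
    rwa [← C_1, natDegree_X_pow_sub_C] at h
  have hsurj : Function.Surjective L := by
    intro y
    obtain ⟨f, rfl⟩ := AdjoinRoot.mk_surjective y
    have hf : (f %ₘ g).natDegree < n := by
      rcases eq_or_ne g 1 with rfl | h1
      · simpa using Nat.pos_of_ne_zero hn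
      · exact (natDegree_modByMonic_lt f hmon h1).trans_le hdeg
    refine ⟨fun i => (f %ₘ g).coeff i, ?_⟩
    change AdjoinRoot.mk g (wordPoly n _) = AdjoinRoot.mk g f
    rw [wordPoly_coeff hf, AdjoinRoot.mk_eq_mk, modByMonic_eq_sub_mul_div, sub_sub_cancel_left,
      dvd_neg]
    exact dvd_mul_right g _
  have h1 := L.finrank_range_add_finrank_ker
  rw [LinearMap.range_eq_top.2 hsurj, finrank_top, hker, Module.finrank_fin_fun,
    (AdjoinRoot.powerBasis' hmon).finrank, AdjoinRoot.powerBasis'_dim] at h1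
  omega

/-- Deleting the parity coordinate is an isomorphism from the extended code onto the code. -/
theorem finrank_extend {n : ℕ} (C : Submodule (ZMod 2) (Fin n → ZMod 2)) :
    Module.finrank (ZMod 2) (extend C) = Module.finrank (ZMod 2) C := by
  let f : extend C →ₗ[ZMod 2] C :=
    { toFun := fun c => ⟨fun i => c.1 i.castSucc, c.2.1⟩
      map_add' := fun _ _ => rfl
      map_smul' := fun _ _ => rfl }
  refine (LinearEquiv.ofBijective f ⟨?_, ?_⟩).finrank_eq
  · rw [← LinearMap.ker_eq_bot, LinearMap.ker_eq_bot']
    rintro ⟨c, hc, hsum⟩ h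
    have h1 : ∀ i : Fin n, c i.castSucc = 0 := fun i => congrFun (congrArg Subtype.val h) i
    have h2 : c (Fin.last n) = 0 := by simpa [Fin.sum_univ_castSucc, h1] using hsum
    refine Subtype.ext (funext fun i => ?_)
    exact Fin.lastCases h2 h1 i
  · rintro ⟨c, hc⟩
    refine ⟨⟨Fin.snoc (α := fun _ => ZMod 2) c (-∑ i, c i), ?_, ?_⟩, ?_⟩
    · simpa using hc
    · simp only [Fin.sum_univ_castSucc, Fin.snoc_castSucc, Fin.snoc_last, add_neg_cancel]
    · exact Subtype.ext (funext fun i => by simp [f])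

end Dimension

/-! ### Supports of extended codewords -/

section ExtendedCode

variable {F : Type*} [Field F] [Fintype F] [Algebra (ZMod 2) F] {m e : ℕ} {α : F}

/-- The labelling of the coordinates of the extended code by the elements of `F`: the cyclic
coordinates are labelled by the powers of `α` and the parity coordinate by `0`. -/
def coordLabel (m : ℕ) (α : F) : Fin (2 ^ m - 1 + 1) → F :=
  Fin.snoc (α := fun _ => F) (fun i => α ^ (i : ℕ)) 0

theorem coordLabel_bijective (hF : Fintype.card F = 2 ^ m) (hm0 : m ≠ 0)
    (hα : IsPrimitiveRoot α (2 ^ m - 1)) : Function.Bijective (coordLabel m α) := by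
  have h1 := Nat.one_lt_two_pow hm0
  have hα0 : α ≠ 0 := hα.ne_zero (by omega)
  rw [Fintype.bijective_iff_injective_and_card]
  refine ⟨?_, by rw [hF, Fintype.card_fin]; omega⟩
  intro i j
  refine Fin.lastCases ?_ (fun i => ?_) i <;> refine Fin.lastCases ?_ (fun j => ?_) j
  · simp
  · intro h
    simp [coordLabel, eq_comm, hα0] at h
  · intro h
    simp [coordLabel, hα0] at h
  · intro h
    simp only [coordLabel, Fin.snoc_castSucc] at h
    exact congrArg Fin.castSucc (Fin.ext (hα.pow_inj i.2 j.2 h))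

theorem sum_smul_eq_sum_support {ι M : Type*} [Fintype ι] [AddCommGroup M] [Module (ZMod 2) M]
    (c : ι → ZMod 2) (f : ι → M) :
    ∑ i, c i • f i = ∑ i ∈ Finset.univ.filter (fun i => c i ≠ 0), f i := by
  rw [Finset.sum_filter]
  refine Finset.sum_congr rfl fun i _ => ?_
  have h : ∀ z : ZMod 2, z = 0 ∨ z = 1 := by decide
  rcases h (c i) with h | h <;> simp [h]

/-- The parity checks of the extended code: the weight is even, and the labels of the support
and their `(1 + 2 ^ e)`-th powers sum to zero. -/
theorem mem_extCode_iff (hm0 : m ≠ 0) (hm : 4 ∣ m) (he : e % 4 = 2)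
    (hα : IsPrimitiveRoot α (2 ^ m - 1)) (c : Fin (2 ^ m - 1 + 1) → ZMod 2) :
    c ∈ extCode m α {e} ↔ Even (hammingNorm c) ∧
      ∑ i ∈ Finset.univ.filter (fun i => c i ≠ 0), coordLabel m α i = 0 ∧
      ∑ i ∈ Finset.univ.filter (fun i => c i ≠ 0), coordLabel m α i ^ (1 + 2 ^ e) = 0 := by
  have h : c ∈ extCode m α {e} ↔
      (fun i : Fin (2 ^ m - 1) => c i.castSucc) ∈ cyclicCode (2 ^ m - 1) (genPoly α {e}) ∧
        ∑ i, c i = 0 := Iff.rfl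
  have hpar : ∑ i, c i = 0 ↔ Even (hammingNorm c) := by
    have := sum_smul_eq_sum_support c (fun _ => (1 : ZMod 2))
    simp only [smul_eq_mul, mul_one, Finset.sum_const, nsmul_eq_mul] at this
    rw [this, ZMod.natCast_eq_zero_iff_even]
    rfl
  rw [h, mem_cyclicCode_iff (genPoly_dvd_X_pow_sub_one hm0 hm he hα),
    genPoly_dvd_iff hm0 hm he hα, aeval_wordPoly, aeval_wordPoly, hpar,
    ← sum_smul_eq_sum_support, ← sum_smul_eq_sum_support]
  simp only [Fin.sum_univ_castSucc, coordLabel, Fin.snoc_castSucc, Fin.snoc_last]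
  simp [pow_right_comm _ (1 + 2 ^ e), and_comm]

/-- Even-weight codewords of the extended code correspond to zero-sum subsets of `F`, via the labels
of their supports. -/
theorem weightCount_extCode (hF : Fintype.card F = 2 ^ m) (hm0 : m ≠ 0) (hm : 4 ∣ m)
    (he : e % 4 = 2) (hα : IsPrimitiveRoot α (2 ^ m - 1)) {k : ℕ} (hk : Even k) :
    weightCount (extCode m α {e}) k = (zeroSumSets F e k).card := by
  classical
  let φ := Equiv.ofBijective _ (coordLabel_bijective hF hm0 hα)
  have hφ : ∀ i, coordLabel m α i = φ i := fun _ => rfl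
  let supp : (Fin (2 ^ m - 1 + 1) → ZMod 2) → Finset (Fin (2 ^ m - 1 + 1)) :=
    fun c => Finset.univ.filter fun i => c i ≠ 0
  have hmem : ∀ c, (supp c).map φ.toEmbedding ∈ zeroSumSets F e k ↔
      c ∈ extCode m α {e} ∧ hammingNorm c = k := by
    intro c
    have hcard : hammingNorm c = (supp c).card := rfl
    rw [mem_extCode_iff hm0 hm he hα]
    simp only [zeroSumSets, Finset.mem_filter, Finset.mem_powersetCard, Finset.subset_univ,
      true_and, Finset.card_map, Finset.sum_map, Equiv.coe_toEmbedding, ← hφ, hcard]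
    constructor
    · rintro ⟨h1, h2⟩
      exact ⟨⟨h1 ▸ hk, h2⟩, h1⟩
    · rintro ⟨⟨_, h2⟩, h1⟩
      exact ⟨h1, h2⟩
  rw [weightCount, ← Set.ncard_coe_finset]
  refine Set.ncard_congr (fun c _ => (supp c).map φ.toEmbedding) ?_ ?_ ?_
  · intro c hc
    exact (hmem c).2 hc
  · intro c d _ _ h
    have h1 : supp c = supp d := Finset.map_injective _ h
    funext i
    have h2 : c i ≠ 0 ↔ d i ≠ 0 := by
      simpa [supp] using congrArg (i ∈ ·) h1
    have h3 : ∀ y z : ZMod 2, (y ≠ 0 ↔ z ≠ 0) → y = z := by decide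
    exact h3 _ _ h2
  · intro W hW
    let c : Fin (2 ^ m - 1 + 1) → ZMod 2 := fun i => if φ i ∈ W then 1 else 0
    have hc : (supp c).map φ.toEmbedding = W := by
      ext x
      obtain ⟨i, rfl⟩ := φ.surjective x
      simp [supp, c]
    exact ⟨c, (hmem c).1 (hc ▸ hW), hc⟩

/-- All weights are even, and weight two is impossible because two distinct labels do not sum to
zero. -/
theorem four_le_hammingNorm (hF : Fintype.card F = 2 ^ m) (hm0 : m ≠ 0) (hm : 4 ∣ m)
    (he : e % 4 = 2) (hα : IsPrimitiveRoot α (2 ^ m - 1)) {c : Fin (2 ^ m - 1 + 1) → ZMod 2}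
    (hc : c ∈ extCode m α {e}) (hc0 : c ≠ 0) : 4 ≤ hammingNorm c := by
  have := charTwo_of_algebra F
  obtain ⟨⟨k, hk⟩, h1, -⟩ := (mem_extCode_iff hm0 hm he hα c).1 hc
  have hpos : hammingNorm c ≠ 0 := hammingNorm_ne_zero_iff.2 hc0
  have h2 : hammingNorm c ≠ 2 := by
    intro h2
    obtain ⟨i, j, hij, hs⟩ := Finset.card_eq_two.1 h2
    rw [hs, Finset.sum_pair hij, CharTwo.add_eq_zero] at h1
    exact hij ((coordLabel_bijective hF hm0 hα).1 h1)
  omega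

theorem isLeast_four (hF : Fintype.card F = 2 ^ m) (hm0 : m ≠ 0) (hm : 4 ∣ m)
    (he : e % 4 = 2) (hα : IsPrimitiveRoot α (2 ^ m - 1))
    (h4 : weightCount (extCode m α {e}) 4 ≠ 0) :
    IsLeast {w : ℕ | ∃ c ∈ extCode m α {e}, c ≠ 0 ∧ hammingNorm c = w} 4 := by
  constructor
  · obtain ⟨c, hc, hw⟩ := Set.nonempty_of_ncard_ne_zero h4
    refine ⟨c, hc, ?_, hw⟩
    rintro rfl
    simp at hw
  · rintro w ⟨c, hc, hc0, rfl⟩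
    exact four_le_hammingNorm hF hm0 hm he hα hc hc0

theorem finrank_extCode (hm0 : m ≠ 0) (hm : 4 ∣ m) (he : e % 4 = 2)
    (hα : IsPrimitiveRoot α (2 ^ m - 1)) :
    Module.finrank (ZMod 2) (extCode m α {e}) =
      2 ^ m - 1 - ((minpoly (ZMod 2) α).natDegree +
        (minpoly (ZMod 2) (α ^ (1 + 2 ^ e))).natDegree) := by
  have h1 := Nat.one_lt_two_pow hm0
  rw [extCode, finrank_extend, finrank_cyclicCode (by omega) (genPoly_monic α e)
    (genPoly_dvd_X_pow_sub_one hm0 hm he hα), genPoly_singleton,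
    (minpoly.monic (.of_finite _ _)).natDegree_mul (minpoly.monic (.of_finite _ _))]

end ExtendedCode

end BinaryCode

theorem mainTheorem4 {F : Type*} [Field F] [Fintype F] [Algebra (ZMod 2) F]
    (m e : ℕ) (hm : m ≡ 0 [MOD 4]) (he : 1 ≤ e) (hem : e ≤ m / 2) (hgcd : Nat.gcd m e = 2)
    (hF : Fintype.card F = 2 ^ m)
    (α : Fˣ) (hα : ∀ x : Fˣ, x ∈ Subgroup.zpowers α) :
    (8 ≤ m → BinaryCode.HasParameters (BinaryCode.extCode m (α : F) {e})
      (2 ^ m) (2 ^ m - 1 - 2 * m) 4) ∧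
    (m = 4 → BinaryCode.HasParameters (BinaryCode.extCode m (α : F) {e}) 16 9 4) ∧
    (BinaryCode.weightCount (BinaryCode.extCode m (α : F) {e}) 4 : ℚ) =
      2 ^ m * (2 ^ m - 1) / 12 ∧
    (BinaryCode.weightCount (BinaryCode.extCode m (α : F) {e}) 6 : ℚ) =
      2 ^ m * (2 ^ m - 1) * (2 ^ (2 * m - 4) + 2 ^ (m - 1) + 6) / 45 ∧
    (BinaryCode.weightCount (BinaryCode.extCode m (α : F) {e}) 8 : ℚ) =
      2 ^ (m - 3) * (2 ^ m - 1) *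
        (2 ^ (4 * m - 4) - 27 * 2 ^ (3 * m - 4) + 23 * 2 ^ (2 * m - 1) +
          261 * 2 ^ (m - 2) + 403) / 315 := by
  have hm4 : 4 ∣ m := (Nat.modEq_zero_iff_dvd).1 hm
  have hm0 : m ≠ 0 := by omega
  obtain ⟨hg', he4⟩ := BinaryCode.exponent_arith hm4 hgcd
  have hprim : IsPrimitiveRoot (α : F) (2 ^ m - 1) := by
    have h := IsPrimitiveRoot.orderOf α
    rw [orderOf_eq_card_of_forall_mem_zpowers hα, Nat.card_units, Nat.card_eq_fintype_card,
      hF] at h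
    exact IsPrimitiveRoot.coe_units_iff.2 h
  obtain ⟨h4, h6, h8⟩ := BinaryCode.card_zeroSumSets (q := 2 ^ m) hF hm4
    (by rw [Nat.gcd_comm, hgcd]) hg' (by rw [hF]; norm_num)
  have hW : ∀ k, Even k → BinaryCode.weightCount (BinaryCode.extCode m (α : F) {e}) k =
      (BinaryCode.zeroSumSets F e k).card := fun k hk =>
    BinaryCode.weightCount_extCode hF hm0 hm4 he4 hprim hk
  have hne : BinaryCode.weightCount (BinaryCode.extCode m (α : F) {e}) 4 ≠ 0 := by
    rw [← Nat.cast_ne_zero (R := ℚ), hW 4 (by decide), h4]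
    have : (1 : ℚ) < 2 ^ m := one_lt_pow₀ (by norm_num) hm0
    exact (div_pos (mul_pos (by linarith) (by linarith)) (by norm_num)).ne'
  have hmin := BinaryCode.isLeast_four hF hm0 hm4 he4 hprim hne
  have hcard : Fintype.card (Fin (2 ^ m - 1 + 1)) = 2 ^ m := by
    rw [Fintype.card_fin, Nat.sub_add_cancel Nat.one_le_two_pow]
  have hdim := BinaryCode.finrank_extCode hm0 hm4 he4 hprim
  rw [BinaryCode.natDegree_minpoly_primitive hF hm0 hprim] at hdim
  have hpow : ∀ {a b : ℕ}, b ≤ a → (2 : ℚ) ^ (a - b) = 2 ^ a / 2 ^ b := fun hab => by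
    rw [pow_sub₀ _ two_ne_zero hab, div_eq_mul_inv]
  refine ⟨fun hm8 => ⟨hcard, ?_, hmin⟩, fun h => ⟨?_, ?_, hmin⟩, ?_, ?_, ?_⟩
  · rw [hdim, BinaryCode.natDegree_minpoly_pow hF hm8 hg' hprim, two_mul]
  · rw [hcard, h]
    norm_num
  · have he2 : e = 2 := by omega
    subst h he2
    rw [hdim, show 1 + 2 ^ 2 = 5 by norm_num, BinaryCode.natDegree_minpoly_pow_five hprim]
    norm_num
  · rw [hW 4 (by decide), h4]
  · rw [hW 6 (by decide), h6, hpow (by omega), hpow (by omega), mul_comm 2 m, pow_mul]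
    norm_num
  · rw [hW 8 (by decide), h8, hpow (by omega), hpow (by omega), hpow (by omega), hpow (by omega),
      hpow (by omega), mul_comm 2 m, mul_comm 3 m, mul_comm 4 m, pow_mul, pow_mul, pow_mul]
    norm_num
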